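/- Let $\mathcal H$ be a complex Hilbert space (inner products are conjugate linear in the first variable), write $|x\rangle\langle y|$ for the operator $v\mapsto\langle y,v\rangle x$, and let $(T_t)_{t\ge 0}$ be a quantum Markov semigroup on $\mathcal B(\mathcal H)$: each $T_t:\mathcal B(\mathcal H)\to\mathcal B(\mathcal H)$ is linear, completely positive and $\sigma$-weakly continuous, $T_0=\mathrm{id}$, $T_{t+s}=T_tT_s$, $T_t(1)=1$, and $t\mapsto T_t(A)$ is $\sigma$-weakly continuous for every $A$. Let $L$ be its generator: $D(L)$ is the set of all $A$ for which $\frac1t(T_t(A)-A)$ converges $\sigma$-weakly as $t\to0^+$, and $L(A)$ is the limit. Let $\mathcal A=\{A\in D(L): A^*A\in D(L),\ AA^*\in D(L)\}$ be the domain algebra of $L$, which is the largest $*$-subalgebra of $\mathcal B(\mathcal H)$ contained in $D(L)$. Let $T\in D(L)$ be a non-zero positive operator of finite rank and let $h$ be an associate vector of $T$: there are orthonormal vectors $k_1',\dots,k_m'$ and numbers $t_1',\dots,t_m'>0$ with $T=\sum_s t_s'|k_s'\rangle\langle k_s'|$ and $h=\sum_s\|k_s\|^{-2}k_s$, where $k_s=\sqrt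 t\,k_s'$ and $t=\sum_s t_s'$. Suppose that $|Th\rangle\langle Th|\in D(L)$. Let $U=\{x\in\mathcal H: |x\rangle\langle Th|\in\mathcal A\}$, a linear subspace that is invariant under $\mathcal A$, and define the linear operator $G:U\to\mathcal H$ by $$Gx=L(|x\rangle\langle Th|)h-\tfrac12\langle h,L(T)h\rangle x .$$ Suppose that there is $C>0$ with $\|L(|x\rangle\langle Th|)h\|\le C\|x\|$ for all $x\in U$. Then: 1. $G$ is bounded on $U$, i.e. there is a constant $C'$ with $\|Gx\|\le C'\|x\|$ for all $x\in U$. 2. Let $\phi$ be a $U$-completely positive map from $\mathcal A$ to the sesquilinear forms on $U\times U$, that is, $\phi$ is linear and $\sum_{i,j=1}^k\phi(A_{ij})(u_i,u_j)\ge0$ for all $k$, all positive operators $(A_{ij})\in\mathcal A\otimes M_k(\mathbb C)$ and all $u_1,\dots,u_k\in U$. Suppose that $$\langle u,L(A)v\rangle=\phi(A)(u,v)+\langle u,GAv\rangle+\langle GA^*u,v\rangle\qquad(A\in\mathcal A,\ u,v\in U).$$ Let $\mathcal K$ be the Hilbert space obtained by completing $(\mathcal A\otimes U)/N$, where $\mathcal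 A\otimes U$ carries the semi-inner product determined by $(A\otimes u,B\otimes v)=\phi(A^*B)(u,v)$ and $N$ is its subspace of null vectors, and let $V:U\to\mathcal K$, $Vx=1\otimes x+N$. Then $V$ is bounded on $U$, i.e. there is a constant $C''$ with $\|Vx\|\le C''\|x\|$ for all $x\in U$. -/

import Mathlib

open scoped ComplexOrder InnerProductSpace TensorProduct NNReal Topology ComplexConjugate
open Filter

set_option linter.unusedSectionVars false

namespace QMS

/-! ### The sigma-weak topology on the bounded operators of a Hilbert space -/

section SigmaWeak

variable {H : Type*} [NormedAddCommGroup H] [InnerProductSpace ℂ H]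

/-- The functional `A ↦ ∑ₙ ⟪xₙ, A yₙ⟫`, i.e. the trace pairing of `A` with the trace class
operator `∑ₙ |yₙ⟩⟨xₙ|` (for square summable sequences `x`, `y`). -/
noncomputable def traceFunctional (x y : ℕ → H) (A : H →L[ℂ] H) : ℂ :=
  ∑' n, ⟪x n, A (y n)⟫_ℂ

/-- Pairs of square summable sequences of vectors; they index the normal functionals. -/
abbrev SqSummablePair (H : Type*) [NormedAddCommGroup H] : Type _ :=
  {p : (ℕ → H) × (ℕ → H) //
    Summable (fun n => ‖p.1 n‖ ^ 2) ∧ Summable (fun n => ‖p.2 n‖ ^ 2)}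

/-- The sigma-weak topology on `B(H)`: the coarsest topology that makes all functionals
`A ↦ ∑ₙ ⟪xₙ, A yₙ⟫` with `∑ₙ ‖xₙ‖² < ∞` and `∑ₙ ‖yₙ‖² < ∞` continuous, that is, the weak-star
topology given by the trace class operators. -/
@[reducible] noncomputable def sigmaWeak (H : Type*) [NormedAddCommGroup H] [InnerProductSpace ℂ H] :
    TopologicalSpace (H →L[ℂ] H) :=
  ⨅ p : SqSummablePair H,
    TopologicalSpace.induced (traceFunctional p.1.1 p.1.2) inferInstance

theorem tendsto_sigmaWeak {ι : Type*} {l : Filter ι} {f : ι → (H →L[ℂ] H)} {B : H →L[ℂ] H} :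
    Tendsto f l (@nhds _ (sigmaWeak H) B) ↔
      ∀ p : SqSummablePair H, Tendsto (fun i => traceFunctional p.1.1 p.1.2 (f i)) l
        (𝓝 (traceFunctional p.1.1 p.1.2 B)) := by
  simp only [nhds_iInf, tendsto_iInf, nhds_induced, tendsto_comap_iff]
  rfl

theorem summable_pair (p : SqSummablePair H) : Summable fun n => ‖p.1.1 n‖ * ‖p.1.2 n‖ := by
  refine Summable.of_nonneg_of_le (fun n => by positivity) (fun n => ?_) (p.2.1.add p.2.2)
  nlinarith [sq_nonneg (‖p.1.1 n‖ - ‖p.1.2 n‖), sq_nonneg (‖p.1.1 n‖), sq_nonneg (‖p.1.2 n‖)]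

theorem norm_term_le (p : SqSummablePair H) (A : H →L[ℂ] H) (n : ℕ) :
    ‖⟪p.1.1 n, A (p.1.2 n)⟫_ℂ‖ ≤ ‖A‖ * (‖p.1.1 n‖ * ‖p.1.2 n‖) := by
  calc ‖⟪p.1.1 n, A (p.1.2 n)⟫_ℂ‖ ≤ ‖p.1.1 n‖ * ‖A (p.1.2 n)‖ := norm_inner_le_norm _ _
    _ ≤ ‖p.1.1 n‖ * (‖A‖ * ‖p.1.2 n‖) := by gcongr; exact A.le_opNorm _
    _ = _ := by ring

theorem summable_term (p : SqSummablePair H) (A : H →L[ℂ] H) :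
    Summable fun n => ⟪p.1.1 n, A (p.1.2 n)⟫_ℂ :=
  Summable.of_norm_bounded ((summable_pair p).mul_left ‖A‖) (norm_term_le p A)

theorem traceFunctional_add (p : SqSummablePair H) (A B : H →L[ℂ] H) :
    traceFunctional p.1.1 p.1.2 (A + B) =
      traceFunctional p.1.1 p.1.2 A + traceFunctional p.1.1 p.1.2 B := by
  simp only [traceFunctional, add_apply, inner_add_right]
  exact (summable_term p A).tsum_add (summable_term p B)

theorem traceFunctional_smul (p : SqSummablePair H) (c : ℂ) (A : H →L[ℂ] H) :
    traceFunctional p.1.1 p.1.2 (c • A) = c * traceFunctional p.1.1 p.1.2 A := by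
  simp only [traceFunctional, smul_apply, inner_smul_right]
  exact tsum_mul_left

theorem traceFunctional_sub (p : SqSummablePair H) (A B : H →L[ℂ] H) :
    traceFunctional p.1.1 p.1.2 (A - B) =
      traceFunctional p.1.1 p.1.2 A - traceFunctional p.1.1 p.1.2 B := by
  have h := traceFunctional_add p A ((-1 : ℂ) • B)
  rw [traceFunctional_smul] at h
  rw [sub_eq_add_neg, ← neg_one_smul ℂ B, h]
  ring

/-- The pair of sequences whose functional is the vector functional `A ↦ ⟪x, A y⟫`. -/
noncomputable def vectorPair (x y : H) : SqSummablePair H :=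
  ⟨(Pi.single 0 x, Pi.single 0 y), by
    constructor <;>
    · refine summable_of_ne_finset_zero (s := {0}) fun n hn => ?_
      simp only [Finset.mem_singleton] at hn
      simp [hn]⟩

theorem traceFunctional_vectorPair (x y : H) (A : H →L[ℂ] H) :
    traceFunctional (vectorPair x y).1.1 (vectorPair x y).1.2 A = ⟪x, A y⟫_ℂ := by
  rw [traceFunctional, tsum_eq_single 0]
  · simp [vectorPair]
  · intro n hn
    simp [vectorPair, hn]

theorem sigmaWeak_unique {ι : Type*} {l : Filter ι} [l.NeBot] {f : ι → (H →L[ℂ] H)}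
    {B C : H →L[ℂ] H} (hB : Tendsto f l (@nhds _ (sigmaWeak H) B))
    (hC : Tendsto f l (@nhds _ (sigmaWeak H) C)) : B = C := by
  ext y
  refine ext_inner_left ℂ fun x => ?_
  rw [← traceFunctional_vectorPair x y B, ← traceFunctional_vectorPair x y C]
  exact tendsto_nhds_unique (tendsto_sigmaWeak.1 hB _) (tendsto_sigmaWeak.1 hC _)

/-- On bounded families, convergence against vector functionals is sigma-weak convergence. -/
theorem tendsto_sigmaWeak_of_bounded {ι : Type*} {l : Filter ι} {f : ι → (H →L[ℂ] H)}
    {B : H →L[ℂ] H} {C : ℝ} (hb : ∀ᶠ i in l, ‖f i‖ ≤ C)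
    (hf : ∀ x y, Tendsto (fun i => ⟪x, f i y⟫_ℂ) l (𝓝 ⟪x, B y⟫_ℂ)) :
    Tendsto f l (@nhds _ (sigmaWeak H) B) := by
  refine tendsto_sigmaWeak.2 fun p => ?_
  refine tendsto_tsum_of_dominated_convergence (bound := fun n => C * (‖p.1.1 n‖ * ‖p.1.2 n‖))
    ((summable_pair p).mul_left C) (fun n => hf _ _) ?_
  filter_upwards [hb] with i hi n
  exact (norm_term_le p (f i) n).trans (by gcongr)

theorem opNorm_le_of_inner {A : H →L[ℂ] H} {C : ℝ} (hC : 0 ≤ C)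
    (h : ∀ x y, ‖⟪x, A y⟫_ℂ‖ ≤ C * ‖x‖ * ‖y‖) : ‖A‖ ≤ C := by
  refine A.opNorm_le_bound hC fun y => ?_
  have h1 := h (A y) y
  rw [inner_self_eq_norm_sq_to_K] at h1
  simp only [Complex.coe_algebraMap, norm_pow, Complex.norm_real, norm_norm] at h1
  by_cases h0 : ‖A y‖ = 0
  · rw [h0]; positivity
  · have : 0 < ‖A y‖ := lt_of_le_of_ne (norm_nonneg _) (Ne.symm h0)
    nlinarith

end SigmaWeak

/-! ### Positive sesquilinear kernels -/

section Kernel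

variable {R U : Type*} [Ring R] [StarRing R] [Algebra ℂ R] [StarModule ℂ R]
  [AddCommGroup U] [Module ℂ U]

/-- The sesquilinear form on `R ⊗ U` given by `(A ⊗ u, B ⊗ v) = ψ(A* B)(u, v)`. -/
noncomputable def tensorForm (ψ : R →ₗ[ℂ] (U →ₗ⋆[ℂ] U →ₗ[ℂ] ℂ)) :
    (R ⊗[ℂ] U) →ₗ⋆[ℂ] (R ⊗[ℂ] U) →ₗ[ℂ] ℂ :=
  TensorProduct.lift (LinearMap.mk₂'ₛₗ (starRingEnd ℂ) (starRingEnd ℂ)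
    (fun A u => TensorProduct.lift (LinearMap.mk₂ ℂ (fun B v => ψ (star A * B) u v)
      (by intros; simp [mul_add]) (by intros; simp) (by intros; simp) (by intros; simp)))
    (by intros; ext; simp [add_mul]) (by intros; ext; simp)
    (by intros; ext; simp) (by intros; ext; simp))

@[simp] theorem tensorForm_tmul (ψ : R →ₗ[ℂ] (U →ₗ⋆[ℂ] U →ₗ[ℂ] ℂ)) (A B : R) (u v : U) :
    tensorForm ψ (A ⊗ₜ u) (B ⊗ₜ v) = ψ (star A * B) u v := by
  simp [tensorForm]

theorem tensorForm_sum (ψ : R →ₗ[ℂ] (U →ₗ⋆[ℂ] U →ₗ[ℂ] ℂ)) {n : ℕ} (A : Fin n → R)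
    (u : Fin n → U) :
    tensorForm ψ (∑ i, A i ⊗ₜ u i) (∑ i, A i ⊗ₜ u i) =
      ∑ i, ∑ j, ψ (star (A i) * A j) (u i) (u j) := by
  simp only [map_sum, LinearMap.sum_apply, tensorForm_tmul]
  exact Finset.sum_comm

theorem tensorForm_nonneg (ψ : R →ₗ[ℂ] (U →ₗ⋆[ℂ] U →ₗ[ℂ] ℂ))
    (h : ∀ (n : ℕ) (A : Fin n → R) (u : Fin n → U),
      0 ≤ ∑ i, ∑ j, ψ (star (A i) * A j) (u i) (u j)) (x : R ⊗[ℂ] U) :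
    0 ≤ tensorForm ψ x x := by
  obtain ⟨n, A, u, rfl⟩ := TensorProduct.exists_sum_tmul_eq x
  rw [tensorForm_sum]
  exact h n A u

/-- A positive sesquilinear form is Hermitian. -/
theorem conj_symm_of_nonneg {E : Type*} [AddCommGroup E] [Module ℂ E]
    (F : E →ₗ⋆[ℂ] E →ₗ[ℂ] ℂ) (h : ∀ x, 0 ≤ F x x) (x y : E) : conj (F y x) = F x y := by
  have i0 : ∀ z, (F z z).im = 0 := fun z => ((Complex.nonneg_iff.1 (h z)).2).symm
  have h1 := i0 (x + y)
  have h2 := i0 (x + Complex.I • y)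
  simp only [map_add, LinearMap.add_apply, LinearMap.map_smulₛₗ, LinearMap.smul_apply,
    smul_eq_mul, Complex.add_im, Complex.mul_im, Complex.mul_re, i0, Complex.conj_I,
    Complex.neg_im, Complex.neg_re, Complex.I_re, Complex.I_im, RingHom.id_apply,
    Complex.add_re] at h1 h2
  apply Complex.ext
  · simp only [Complex.conj_re]; linarith
  · simp only [Complex.conj_im]; linarith

theorem form_add_le {E : Type*} [AddCommGroup E] [Module ℂ E]
    (F : E →ₗ⋆[ℂ] E →ₗ[ℂ] ℂ) (h : ∀ x, 0 ≤ F x x) (x y : E) :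
    (F (x + y) (x + y)).re ≤ 2 * (F x x).re + 2 * (F y y).re := by
  have h1 := (Complex.nonneg_iff.1 (h (x - y))).1
  simp only [map_add, map_sub, LinearMap.add_apply, LinearMap.sub_apply, Complex.add_re,
    Complex.sub_re] at h1 ⊢
  linarith

end Kernel

/-! ### Completely positive maps and quantum Markov semigroups on `B(H)` -/

section Semigroup

variable {H : Type*} [NormedAddCommGroup H] [InnerProductSpace ℂ H]

/-- A `k × k` matrix of bounded operators on `H` is positive if it is a positive operator on the
Hilbert space `H ⊕ ⋯ ⊕ H` (`k` summands). -/
def IsPositiveMatrix {k : ℕ} (A : Matrix (Fin k) (Fin k) (H →L[ℂ] H)) : Prop :=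
  ∀ u : Fin k → H, 0 ≤ ∑ i, ∑ j, ⟪u i, A i j (u j)⟫_ℂ

/-- `Φ` is completely positive: all its amplifications to matrices are positive. -/
def IsCompletelyPositive (Φ : (H →L[ℂ] H) →ₗ[ℂ] (H →L[ℂ] H)) : Prop :=
  ∀ (k : ℕ) (A : Matrix (Fin k) (Fin k) (H →L[ℂ] H)),
    IsPositiveMatrix A → IsPositiveMatrix (A.map Φ)

/-- A quantum Markov semigroup on `B(H)`. -/
structure QuantumMarkovSemigroup (H : Type*) [NormedAddCommGroup H] [InnerProductSpace ℂ H] where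
  /-- The operator at time `t`. -/
  map : ℝ≥0 → ((H →L[ℂ] H) →ₗ[ℂ] (H →L[ℂ] H))
  sigmaWeak_continuous : ∀ t, Continuous[sigmaWeak H, sigmaWeak H] (map t)
  completelyPositive : ∀ t, IsCompletelyPositive (map t)
  map_zero : map 0 = LinearMap.id
  map_add : ∀ t s, map (t + s) = map t ∘ₗ map s
  orbit_continuous : ∀ A, Continuous[inferInstance, sigmaWeak H] (fun t => map t A)
  map_one : ∀ t, map t 1 = 1

namespace QuantumMarkovSemigroup

variable (S : QuantumMarkovSemigroup H)

/-- `S.HasDeriv A B` says that `t⁻¹ (T_t A - A)` converges sigma-weakly to `B` as `t → 0+`. -/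
def HasDeriv (A B : H →L[ℂ] H) : Prop :=
  Tendsto (fun t : ℝ≥0 => ((t : ℝ) : ℂ)⁻¹ • (S.map t A - A)) (𝓝[>] 0) (@nhds _ (sigmaWeak H) B)

variable {S}

theorem HasDeriv.add {A B A' B' : H →L[ℂ] H} (h : S.HasDeriv A B) (h' : S.HasDeriv A' B') :
    S.HasDeriv (A + A') (B + B') := by
  refine tendsto_sigmaWeak.2 fun p => ?_
  rw [traceFunctional_add]
  refine ((tendsto_sigmaWeak.1 h p).add (tendsto_sigmaWeak.1 h' p)).congr fun t => ?_
  rw [← traceFunctional_add, ← smul_add, _root_.map_add]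
  congr 2
  abel

theorem HasDeriv.smul {A B : H →L[ℂ] H} (c : ℂ) (h : S.HasDeriv A B) :
    S.HasDeriv (c • A) (c • B) := by
  refine tendsto_sigmaWeak.2 fun p => ?_
  rw [traceFunctional_smul]
  refine ((tendsto_sigmaWeak.1 h p).const_mul c).congr fun t => ?_
  rw [← traceFunctional_smul, smul_comm, _root_.map_smul, smul_sub]

theorem hasDeriv_one : S.HasDeriv 1 0 := by
  refine tendsto_sigmaWeak.2 fun p => ?_
  simp only [S.map_one, sub_self, smul_zero]
  exact tendsto_const_nhds

theorem hasDeriv_zero : S.HasDeriv 0 0 := by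
  simpa using (hasDeriv_one (S := S)).smul 0

theorem HasDeriv.unique {A B C : H →L[ℂ] H} (h : S.HasDeriv A B) (h' : S.HasDeriv A C) : B = C :=
  sigmaWeak_unique h h'

variable (S)

/-- The (unbounded) infinitesimal generator `L` of the semigroup: its domain `D(L)` consists of
all `A` for which `t⁻¹ (T_t A - A)` converges sigma-weakly as `t → 0+`, and `L A` is the limit. -/
noncomputable def generator : (H →L[ℂ] H) →ₗ.[ℂ] (H →L[ℂ] H) where
  domain :=
    { carrier := {A | ∃ B, S.HasDeriv A B}
      add_mem' := fun ⟨B, h⟩ ⟨B', h'⟩ => ⟨B + B', h.add h'⟩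
      zero_mem' := ⟨0, hasDeriv_zero⟩
      smul_mem' := fun c _ ⟨B, h⟩ => ⟨c • B, h.smul c⟩ }
  toFun :=
    { toFun := fun A => A.2.choose
      map_add' := fun A A' =>
        ((A + A').2.choose_spec).unique (A.2.choose_spec.add A'.2.choose_spec)
      map_smul' := fun c A => ((c • A).2.choose_spec).unique (A.2.choose_spec.smul c) }

theorem mem_domain {A : H →L[ℂ] H} : A ∈ S.generator.domain ↔ ∃ B, S.HasDeriv A B := Iff.rfl

theorem generator_hasDeriv (A : S.generator.domain) :
    S.HasDeriv (A : H →L[ℂ] H) (S.generator A) :=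
  A.2.choose_spec

end QuantumMarkovSemigroup

end Semigroup


/-! ### Estimates for completely positive maps -/

section CP

variable {H : Type*} [NormedAddCommGroup H] [InnerProductSpace ℂ H]

/-- The map `A ↦ ((u, v) ↦ ⟪u, Φ(A) v⟫)`. -/
noncomputable def opForm (Φ : (H →L[ℂ] H) →ₗ[ℂ] (H →L[ℂ] H)) :
    (H →L[ℂ] H) →ₗ[ℂ] (H →ₗ⋆[ℂ] H →ₗ[ℂ] ℂ) where
  toFun A := LinearMap.mk₂'ₛₗ (starRingEnd ℂ) (RingHom.id ℂ) (fun u v => ⟪u, Φ A v⟫_ℂ)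
    (by intros; simp) (by intros; simp [mul_comm]) (by intros; simp) (by intros; simp)
  map_add' A B := by ext u v; simp
  map_smul' c A := by ext u v; simp

@[simp] theorem opForm_apply (Φ : (H →L[ℂ] H) →ₗ[ℂ] (H →L[ℂ] H)) (A : H →L[ℂ] H) (u v : H) :
    opForm Φ A u v = ⟪u, Φ A v⟫_ℂ := rfl

theorem inner_self_ofReal (x : H) : ⟪x, x⟫_ℂ = ((‖x‖ ^ 2 : ℝ) : ℂ) := by
  rw [inner_self_eq_norm_sq_to_K]
  simp

variable [CompleteSpace H] {Φ : (H →L[ℂ] H) →ₗ[ℂ] (H →L[ℂ] H)}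

theorem isPositiveMatrix_gram {k : ℕ} (A : Fin k → (H →L[ℂ] H)) :
    IsPositiveMatrix (Matrix.of fun i j => star (A i) * A j) := by
  intro u
  have : ∑ i, ∑ j, ⟪u i, (Matrix.of fun i j => star (A i) * A j) i j (u j)⟫_ℂ =
      ⟪∑ i, A i (u i), ∑ j, A j (u j)⟫_ℂ := by
    simp only [sum_inner, inner_sum, Matrix.of_apply, ContinuousLinearMap.star_eq_adjoint,
      mul_apply_eq_comp, ContinuousLinearMap.adjoint_inner_right]
    exact Finset.sum_comm
  rw [this, inner_self_ofReal]
  exact Complex.zero_le_real.2 (sq_nonneg _)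

theorem IsCompletelyPositive.tensorForm_nonneg (h : IsCompletelyPositive Φ)
    (x : (H →L[ℂ] H) ⊗[ℂ] H) : 0 ≤ tensorForm (opForm Φ) x x := by
  refine QMS.tensorForm_nonneg (opForm Φ) (fun n A u => ?_) x
  have h1 := h n _ (isPositiveMatrix_gram A) u
  simp only [Matrix.map_apply, Matrix.of_apply] at h1
  simp only [opForm_apply]
  exact h1

theorem IsCompletelyPositive.map_star (h : IsCompletelyPositive Φ) (A : H →L[ℂ] H) :
    Φ (star A) = star (Φ A) := by
  ext v
  refine ext_inner_left ℂ fun u => ?_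
  have := conj_symm_of_nonneg _ h.tensorForm_nonneg (A ⊗ₜ u) (1 ⊗ₜ v)
  simp only [tensorForm_tmul, opForm_apply, star_one, one_mul, mul_one] at this
  rw [← this, inner_conj_symm, ContinuousLinearMap.star_eq_adjoint (Φ A),
    ContinuousLinearMap.adjoint_inner_right]

/-- Left multiplication on the tensor product. -/
noncomputable def lmul (A : H →L[ℂ] H) :
    ((H →L[ℂ] H) ⊗[ℂ] H) →ₗ[ℂ] ((H →L[ℂ] H) ⊗[ℂ] H) :=
  LinearMap.rTensor H (LinearMap.mulLeft ℂ A)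

@[simp] theorem lmul_tmul (A B : H →L[ℂ] H) (u : H) : lmul A (B ⊗ₜ u) = (A * B) ⊗ₜ u := rfl

theorem IsCompletelyPositive.lmul_le (h : IsCompletelyPositive Φ) (A : H →L[ℂ] H)
    (x : (H →L[ℂ] H) ⊗[ℂ] H) :
    (tensorForm (opForm Φ) (lmul A x) (lmul A x)).re ≤
      ‖A‖ ^ 2 * (tensorForm (opForm Φ) x x).re := by
  obtain ⟨n, B, u, rfl⟩ := TensorProduct.exists_sum_tmul_eq x
  have hpos : IsPositiveMatrix (Matrix.of fun i j =>
      ((‖A‖ ^ 2 : ℝ) : ℂ) • (star (B i) * B j) - star (A * B i) * (A * B j)) := by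
    intro w
    have : ∑ i, ∑ j, ⟪w i, (Matrix.of fun i j =>
        ((‖A‖ ^ 2 : ℝ) : ℂ) • (star (B i) * B j) - star (A * B i) * (A * B j)) i j (w j)⟫_ℂ =
        ((‖A‖ ^ 2 : ℝ) : ℂ) * ⟪∑ i, B i (w i), ∑ j, B j (w j)⟫_ℂ -
          ⟪A (∑ i, B i (w i)), A (∑ j, B j (w j))⟫_ℂ := by
      simp only [map_sum, sum_inner, inner_sum, Matrix.of_apply,
        sub_apply, smul_apply, inner_sub_right, inner_smul_right,
        ContinuousLinearMap.star_eq_adjoint, Finset.sum_sub_distrib, Finset.mul_sum,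
        mul_apply_eq_comp, ContinuousLinearMap.adjoint_inner_right]
      congr 1 <;> exact Finset.sum_comm
    rw [this, inner_self_ofReal, inner_self_ofReal]
    have h2 := A.le_opNorm (∑ i, B i (w i))
    have h3 : ‖A (∑ i, B i (w i))‖ ^ 2 ≤ ‖A‖ ^ 2 * ‖∑ i, B i (w i)‖ ^ 2 := by
      rw [← mul_pow]; gcongr
    rw [sub_nonneg, ← Complex.ofReal_mul]
    exact Complex.real_le_real.2 h3
  have h1 := h n _ hpos u
  simp only [map_sum, lmul_tmul]
  have h2 : ∑ i, ∑ j, ⟪u i, ((Matrix.of fun i j => ((‖A‖ ^ 2 : ℝ) : ℂ) • (star (B i) * B j) -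
      star (A * B i) * (A * B j)).map Φ) i j (u j)⟫_ℂ =
      ((‖A‖ ^ 2 : ℝ) : ℂ) * (∑ i, ∑ j, ⟪u i, Φ (star (B i) * B j) (u j)⟫_ℂ) -
       ∑ i, ∑ j, ⟪u i, Φ (star (A * B i) * (A * B j)) (u j)⟫_ℂ := by
    simp only [Matrix.map_apply, Matrix.of_apply, map_sub, map_smul, sub_apply, smul_apply,
      inner_sub_right, inner_smul_right, Finset.sum_sub_distrib, Finset.mul_sum]
  rw [h2] at h1
  have h3 := (Complex.nonneg_iff.1 h1).1
  rw [Complex.sub_re, Complex.re_ofReal_mul] at h3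
  have e1 := tensorForm_sum (opForm Φ) B u
  have e2 := tensorForm_sum (opForm Φ) (fun i => A * B i) u
  simp only [map_sum, opForm_apply] at e1 e2 ⊢
  rw [e1, e2]
  linarith

/-- The defect vector `A ⊗ u - 1 ⊗ Φ(A) u`. -/
noncomputable def defect (Φ : (H →L[ℂ] H) →ₗ[ℂ] (H →L[ℂ] H)) (A : H →L[ℂ] H) (u : H) :
    (H →L[ℂ] H) ⊗[ℂ] H :=
  A ⊗ₜ u - 1 ⊗ₜ (Φ A u)

theorem IsCompletelyPositive.form_defect (h : IsCompletelyPositive Φ) (h1 : Φ 1 = 1)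
    (A : H →L[ℂ] H) (u : H) :
    tensorForm (opForm Φ) (defect Φ A u) (defect Φ A u) =
      ⟪u, (Φ (star A * A) - star (Φ A) * Φ A) u⟫_ℂ := by
  simp only [defect, map_sub, LinearMap.sub_apply, tensorForm_tmul, opForm_apply, star_one,
    one_mul, mul_one, h1, h.map_star, sub_apply, inner_sub_right, mul_apply_eq_comp,
    one_apply_eq_self]
  simp only [ContinuousLinearMap.star_eq_adjoint, ContinuousLinearMap.adjoint_inner_right]
  ring

theorem form_one (h1 : Φ 1 = 1) (u : H) :
    tensorForm (opForm Φ) (1 ⊗ₜ u) (1 ⊗ₜ u) = ((‖u‖ ^ 2 : ℝ) : ℂ) := by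
  rw [tensorForm_tmul, opForm_apply, star_one, one_mul, h1, one_apply_eq_self, inner_self_ofReal]

theorem IsCompletelyPositive.contraction (h : IsCompletelyPositive Φ) (h1 : Φ 1 = 1)
    (A : H →L[ℂ] H) : ‖Φ A‖ ≤ ‖A‖ := by
  refine ContinuousLinearMap.opNorm_le_bound _ (norm_nonneg _) fun u => ?_
  have e1 := (Complex.nonneg_iff.1 (h.tensorForm_nonneg (defect Φ A u))).1
  have e2 := h.lmul_le A (1 ⊗ₜ u)
  rw [form_one h1, lmul_tmul, mul_one, tensorForm_tmul, opForm_apply, Complex.ofReal_re] at e2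
  rw [h.form_defect h1, sub_apply, inner_sub_right, Complex.sub_re, mul_apply_eq_comp,
    ContinuousLinearMap.star_eq_adjoint (Φ A), ContinuousLinearMap.adjoint_inner_right,
    inner_self_ofReal, Complex.ofReal_re] at e1
  refine (sq_le_sq₀ (norm_nonneg _) (by positivity)).1 ?_
  rw [mul_pow]
  linarith

/-- The defect vector of a product. -/
theorem defect_mul (A B : H →L[ℂ] H) (u : H) :
    defect Φ (A * B) u = lmul A (defect Φ B u) + (defect Φ A (Φ B u) +
      1 ⊗ₜ ((Φ A * Φ B - Φ (A * B)) u)) := by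
  simp only [defect, map_sub, lmul_tmul, mul_one, sub_apply, mul_apply_eq_comp,
    TensorProduct.tmul_sub]
  abel

theorem defect_add (A B : H →L[ℂ] H) (u : H) :
    defect Φ (A + B) u = defect Φ A u + defect Φ B u := by
  simp only [defect, map_add, add_apply, TensorProduct.tmul_add, TensorProduct.add_tmul]
  abel

end CP

/-! ### The domain of the generator as a Favard class -/

section Favard

variable {H : Type*} [NormedAddCommGroup H] [InnerProductSpace ℂ H] [CompleteSpace H]

namespace QuantumMarkovSemigroup

variable (S : QuantumMarkovSemigroup H)

theorem norm_map_le (t : ℝ≥0) (A : H →L[ℂ] H) : ‖S.map t A‖ ≤ ‖A‖ :=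
  (S.completelyPositive t).contraction (S.map_one t) A

theorem continuous_traceFunctional_map (p : SqSummablePair H) (A : H →L[ℂ] H) :
    Continuous fun t : ℝ => traceFunctional p.1.1 p.1.2 (S.map t.toNNReal A) := by
  refine Continuous.comp (g := fun t : ℝ≥0 => traceFunctional p.1.1 p.1.2 (S.map t A)) ?_
    continuous_real_toNNReal
  refine continuous_iff_continuousAt.2 fun t => ?_
  have h := (@continuous_iff_continuousAt _ _ _ (sigmaWeak H) _).1 (S.orbit_continuous A) t
  exact tendsto_sigmaWeak.1 h p

variable {S}

theorem tendsto_map {ι : Type*} {l : Filter ι} {f : ι → (H →L[ℂ] H)} {B : H →L[ℂ] H} (t : ℝ≥0)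
    (h : Tendsto f l (@nhds _ (sigmaWeak H) B)) :
    Tendsto (fun i => S.map t (f i)) l (@nhds _ (sigmaWeak H) (S.map t B)) := by
  have h1 := (@continuous_iff_continuousAt _ _ (sigmaWeak H) (sigmaWeak H) _).1
    (S.sigmaWeak_continuous t) B
  exact Tendsto.comp h1 h

theorem slope_eq (p : SqSummablePair H) (A : H →L[ℂ] H) (t s : ℝ≥0) :
    traceFunctional p.1.1 p.1.2 (S.map t (((s : ℝ) : ℂ)⁻¹ • (S.map s A - A))) =
      ((s : ℝ) : ℂ)⁻¹ * (traceFunctional p.1.1 p.1.2 (S.map (t + s) A) -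
        traceFunctional p.1.1 p.1.2 (S.map t A)) := by
  rw [_root_.map_smul, traceFunctional_smul, map_sub, traceFunctional_sub, S.map_add]
  rfl

theorem tendsto_sub_toNNReal (x : ℝ) :
    Tendsto (fun z : ℝ => (z - x).toNNReal) (𝓝[>] x) (𝓝[>] 0) := by
  refine tendsto_nhdsWithin_iff.2 ⟨?_, ?_⟩
  · have : Continuous fun z : ℝ => (z - x).toNNReal := by fun_prop
    refine (this.tendsto' x 0 (by simp)).mono_left nhdsWithin_le_nhds
  · filter_upwards [self_mem_nhdsWithin] with z hz
    simpa using hz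

theorem tendsto_add_coe (x : ℝ) :
    Tendsto (fun s : ℝ≥0 => x + (s : ℝ)) (𝓝[>] 0) (𝓝[>] x) := by
  refine tendsto_nhdsWithin_iff.2 ⟨?_, ?_⟩
  · have : Continuous fun s : ℝ≥0 => x + (s : ℝ) := by fun_prop
    refine (this.tendsto' 0 x (by simp)).mono_left nhdsWithin_le_nhds
  · filter_upwards [self_mem_nhdsWithin] with s hs
    have : 0 < (s : ℝ) := hs
    simpa using this

theorem HasDeriv.norm_sub_le {A B : H →L[ℂ] H} (h : S.HasDeriv A B) (t : ℝ≥0) :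
    ‖S.map t A - A‖ ≤ ‖B‖ * t := by
  refine opNorm_le_of_inner (by positivity) fun x y => ?_
  set p := vectorPair x y with hp
  have key := norm_image_sub_le_of_norm_deriv_right_le_segment (a := 0) (b := (t : ℝ))
    (f := fun r : ℝ => traceFunctional p.1.1 p.1.2 (S.map r.toNNReal A))
    (f' := fun r : ℝ => traceFunctional p.1.1 p.1.2 (S.map r.toNNReal B))
    (C := ‖B‖ * ‖x‖ * ‖y‖) (S.continuous_traceFunctional_map p A).continuousOn ?_ ?_ t
    ⟨t.coe_nonneg, le_rfl⟩
  · simp only [Real.toNNReal_coe, Real.toNNReal_zero, S.map_zero, LinearMap.id_apply,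
      ← traceFunctional_sub] at key
    rw [hp, traceFunctional_vectorPair] at key
    linarith
  · intro r hr
    rw [← hasDerivWithinAt_Ioi_iff_Ici, hasDerivWithinAt_iff_tendsto_slope' (by simp)]
    have h1 := (tendsto_sigmaWeak.1 (tendsto_map (S := S) r.toNNReal h) p).comp (tendsto_sub_toNNReal r)
    refine h1.congr' ?_
    filter_upwards [self_mem_nhdsWithin] with z hz
    have hz' : r < z := hz
    have hr0 : 0 ≤ r := hr.1
    have e : r.toNNReal + (z - r).toNNReal = z.toNNReal := by
      rw [← Real.toNNReal_add hr0 (by linarith)]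
      congr 1; ring
    rw [Function.comp_apply, slope_eq, e, slope_def_module, Real.coe_toNNReal _ (by linarith),
      Complex.real_smul, Complex.ofReal_inv]
  · intro r _
    rw [hp, traceFunctional_vectorPair]
    calc ‖⟪x, S.map r.toNNReal B y⟫_ℂ‖ ≤ ‖x‖ * ‖S.map r.toNNReal B y‖ := norm_inner_le_norm _ _
      _ ≤ ‖x‖ * (‖S.map r.toNNReal B‖ * ‖y‖) := by
        gcongr; exact ContinuousLinearMap.le_opNorm _ _
      _ ≤ ‖x‖ * (‖B‖ * ‖y‖) := by gcongr; exact S.norm_map_le _ _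
      _ = _ := by ring

/-- Bounded families of operators have limits along ultrafilters. -/
theorem exists_ultrafilter_limit {ι : Type*} (l : Ultrafilter ι) (f : ι → (H →L[ℂ] H)) {C : ℝ}
    (hb : ∀ᶠ i in (l : Filter ι), ‖f i‖ ≤ C) :
    ∃ B : H →L[ℂ] H, Tendsto f l (@nhds _ (sigmaWeak H) B) := by
  have hbd : ∀ x y : H, ∀ᶠ i in (l : Filter ι), ‖⟪f i x, y⟫_ℂ‖ ≤ C * ‖x‖ * ‖y‖ := by
    intro x y
    filter_upwards [hb] with i hi
    calc ‖⟪f i x, y⟫_ℂ‖ ≤ ‖f i x‖ * ‖y‖ := norm_inner_le_norm _ _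
      _ ≤ (‖f i‖ * ‖x‖) * ‖y‖ := by gcongr; exact ContinuousLinearMap.le_opNorm _ _
      _ ≤ _ := by gcongr
  have hex : ∀ x y : H, ∃ z : ℂ, Tendsto (fun i => ⟪f i x, y⟫_ℂ) l (𝓝 z) := by
    intro x y
    obtain ⟨z, -, hz⟩ := (isCompact_closedBall (0 : ℂ) (C * ‖x‖ * ‖y‖)).ultrafilter_le_nhds
      (l.map fun i => ⟪f i x, y⟫_ℂ) (by
        rw [le_principal_iff, Ultrafilter.mem_coe, Ultrafilter.mem_map]
        refine mem_of_superset (hbd x y) fun i hi => ?_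
        simpa using hi)
    exact ⟨z, hz⟩
  choose b hb' using hex
  let bl : H →ₗ⋆[ℂ] H →ₗ[ℂ] ℂ := LinearMap.mk₂'ₛₗ (starRingEnd ℂ) (RingHom.id ℂ) b
    (fun x x' y => tendsto_nhds_unique (hb' _ _) (((hb' x y).add (hb' x' y)).congr fun i => by
      rw [_root_.map_add, inner_add_left]))
    (fun c x y => tendsto_nhds_unique (hb' _ _) (((hb' x y).const_mul (conj c)).congr fun i => by
      rw [_root_.map_smul, inner_smul_left]))
    (fun x y y' => tendsto_nhds_unique (hb' _ _) (((hb' x y).add (hb' x y')).congr fun i => by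
      rw [inner_add_right]))
    (fun c x y => tendsto_nhds_unique (hb' _ _) (((hb' x y).const_mul c).congr fun i => by
      rw [inner_smul_right]))
  have hle : ∀ x y, ‖bl x y‖ ≤ C * ‖x‖ * ‖y‖ := fun x y => by
    exact le_of_tendsto (hb' x y).norm (hbd x y)
  let B := InnerProductSpace.continuousLinearMapOfBilin (LinearMap.mkContinuous₂ bl C hle)
  have hB : ∀ x y, ⟪B x, y⟫_ℂ = b x y := fun x y => by
    rw [InnerProductSpace.continuousLinearMapOfBilin_apply]
    rfl
  refine ⟨B, tendsto_sigmaWeak_of_bounded hb fun x y => ?_⟩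
  have h1 := (Complex.continuous_conj.tendsto _).comp (hb' y x)
  rw [← inner_conj_symm, hB]
  refine h1.congr fun i => ?_
  rw [Function.comp_apply, inner_conj_symm]

theorem mem_domain_of_norm_sub_le {A : H →L[ℂ] H} {C : ℝ}
    (h : ∀ t : ℝ≥0, ‖S.map t A - A‖ ≤ C * t) : A ∈ S.generator.domain := by
  let l : Ultrafilter ℝ≥0 := Ultrafilter.of (𝓝[>] 0)
  have hl : (l : Filter ℝ≥0) ≤ 𝓝[>] 0 := Ultrafilter.of_le _
  have hbd : ∀ᶠ s : ℝ≥0 in 𝓝[>] 0, ‖((s : ℝ) : ℂ)⁻¹ • (S.map s A - A)‖ ≤ C := by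
    filter_upwards [self_mem_nhdsWithin] with s hs
    have hs' : 0 < (s : ℝ) := hs
    rw [norm_smul, norm_inv, Complex.norm_real, Real.norm_of_nonneg hs'.le, inv_mul_le_iff₀ hs',
      mul_comm]
    exact h s
  obtain ⟨B, hB⟩ := exists_ultrafilter_limit l _ (hl hbd)
  refine ⟨B, tendsto_sigmaWeak.2 fun p => ?_⟩
  set f : ℝ → ℂ := fun r => traceFunctional p.1.1 p.1.2 (S.map r.toNNReal A) with hf
  set g : ℝ → ℂ := fun r => traceFunctional p.1.1 p.1.2 (S.map r.toNNReal B) with hg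
  have hfc : Continuous f := S.continuous_traceFunctional_map p A
  have hgc : Continuous g := S.continuous_traceFunctional_map p B
  set k : ℝ → ℂ := fun r => ∫ s in (0 : ℝ)..r, g s with hk
  have hkd : ∀ r, HasDerivAt k (g r) r := fun r =>
    (hgc.integral_hasStrictDerivAt 0 r).hasDerivAt
  have hkc : Continuous k := continuous_iff_continuousAt.2 fun r => (hkd r).continuousAt
  -- difference quotients of `k` and `f` at `r`
  have hkq : ∀ r, Tendsto (fun s : ℝ≥0 => ((s : ℝ) : ℂ)⁻¹ * (k (r + s) - k r)) (𝓝[>] 0)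
      (𝓝 (g r)) := by
    intro r
    have h1 := (hasDerivWithinAt_iff_tendsto_slope' (s := Set.Ioi r) (by simp)).1
      (hkd r).hasDerivWithinAt
    refine (h1.comp (tendsto_add_coe r)).congr fun s => ?_
    rw [Function.comp_apply, slope_def_module, Complex.real_smul, Complex.ofReal_inv]
    congr 3
    ring
  have hfq : ∀ r, 0 ≤ r → Tendsto (fun s : ℝ≥0 => ((s : ℝ) : ℂ)⁻¹ * (f (r + s) - f r)) l
      (𝓝 (g r)) := by
    intro r hr
    refine (tendsto_sigmaWeak.1 (tendsto_map r.toNNReal hB) p).congr fun s => ?_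
    rw [slope_eq, hf]
    simp only
    rw [Real.toNNReal_add hr s.coe_nonneg, Real.toNNReal_coe]
  have heq : ∀ r, 0 ≤ r → f r = f 0 + k r := by
    intro r hr
    have h0 := image_le_of_liminf_slope_right_le_deriv_boundary (a := 0) (b := r)
      (f := fun r => ‖f r - f 0 - k r‖) (B := fun _ => 0) (B' := fun _ => 0)
      (by fun_prop) (by simp [hk]) continuousOn_const
      (fun x _ => hasDerivWithinAt_const _ _ _) (fun x hx c hc => by
        have h2 := ((hfq x hx.1).sub ((hkq x).mono_left hl)).norm
        rw [sub_self, norm_zero] at h2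
        refine (tendsto_add_coe x).frequently ?_
        have h3 : ∀ᶠ s : ℝ≥0 in (l : Filter ℝ≥0), 0 < s := hl self_mem_nhdsWithin
        refine Filter.Frequently.filter_mono ?_ hl
        refine Filter.Eventually.frequently ?_
        filter_upwards [h2.eventually (gt_mem_nhds hc), h3] with s hs hs0
        have hs' : 0 < (s : ℝ) := hs0
        refine lt_of_le_of_lt ?_ hs
        rw [slope_def_field, add_sub_cancel_left, ← mul_sub, norm_mul, norm_inv, Complex.norm_real,
          Real.norm_of_nonneg hs'.le, div_eq_inv_mul]
        gcongr
        refine (norm_sub_norm_le _ _).trans (le_of_eq ?_)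
        congr 1
        ring) ⟨hr, le_rfl⟩
    have h1 : f r - f 0 - k r = 0 := norm_le_zero_iff.1 h0
    linear_combination h1
  have h0 := hkq 0
  have hg0 : g 0 = traceFunctional p.1.1 p.1.2 B := by
    rw [hg]; simp [S.map_zero]
  rw [← hg0]
  refine h0.congr fun s => ?_
  have e1 : k 0 = 0 := by simp [hk]
  have e2 := heq s s.coe_nonneg
  have e3 := slope_eq (S := S) p A 0 s
  rw [S.map_zero] at e3
  simp only [LinearMap.id_apply, zero_add] at e3
  rw [e3, zero_add, e1, sub_zero]
  congr 1
  have e4 : f s = traceFunctional p.1.1 p.1.2 (S.map s A) := by rw [hf]; simp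
  have e5 : f 0 = traceFunctional p.1.1 p.1.2 A := by rw [hf]; simp [S.map_zero]
  rw [← e4, ← e5, e2]
  ring

theorem mem_domain_iff {A : H →L[ℂ] H} :
    A ∈ S.generator.domain ↔ ∃ C : ℝ, ∀ t : ℝ≥0, ‖S.map t A - A‖ ≤ C * t :=
  ⟨fun ⟨B, h⟩ => ⟨‖B‖, h.norm_sub_le⟩, fun ⟨_, h⟩ => mem_domain_of_norm_sub_le h⟩

end QuantumMarkovSemigroup

end Favard

/-! ### The domain algebra -/

section DomainAlgebra

variable {H : Type*} [NormedAddCommGroup H] [InnerProductSpace ℂ H] [CompleteSpace H]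

theorem norm_le_of_form_le {X : H →L[ℂ] H} {c : ℝ} (hc : 0 ≤ c) (h0 : ∀ u, 0 ≤ ⟪u, X u⟫_ℂ)
    (h1 : ∀ u, (⟪u, X u⟫_ℂ).re ≤ c * ‖u‖ ^ 2) : ‖X‖ ≤ c := by
  have hX : 0 ≤ X := by
    rw [ContinuousLinearMap.nonneg_iff_isPositive, ContinuousLinearMap.isPositive_iff_complex]
    intro u
    have h := Complex.nonneg_iff.1 (h0 u)
    rw [← inner_conj_symm u] at h
    simp only [Complex.conj_re, Complex.conj_im] at h
    refine ⟨Complex.ext rfl ?_, h.1⟩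
    simp only [Complex.ofReal_im]
    linarith [h.2]
  rw [CStarAlgebra.norm_le_iff_le_algebraMap X hc hX, ContinuousLinearMap.le_def,
    ContinuousLinearMap.isPositive_iff_complex]
  intro u
  have e : ⟪(algebraMap ℝ (H →L[ℂ] H) c - X) u, u⟫_ℂ =
      ((c * ‖u‖ ^ 2 : ℝ) : ℂ) - conj ⟪u, X u⟫_ℂ := by
    rw [sub_apply, inner_sub_left, inner_conj_symm, Algebra.algebraMap_eq_smul_one, smul_apply,
      one_apply_eq_self, RCLike.real_smul_eq_coe_smul (K := ℂ) c u, inner_smul_left,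
      inner_self_ofReal, Complex.ofReal_mul]
    congr 2
    exact Complex.conj_ofReal c
  have h := Complex.nonneg_iff.1 (h0 u)
  rw [e]
  have h2 := h1 u
  refine ⟨Complex.ext rfl ?_, ?_⟩
  · rw [Complex.ofReal_im, Complex.sub_im, Complex.ofReal_im, Complex.conj_im, ← h.2]
    simp
  · simp only [Complex.sub_re, Complex.ofReal_re, Complex.conj_re, RCLike.re_eq_complex_re]
    linarith

namespace QuantumMarkovSemigroup

variable {S : QuantumMarkovSemigroup H}

theorem star_mem_domain {A : H →L[ℂ] H} (h : A ∈ S.generator.domain) :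
    star A ∈ S.generator.domain := by
  obtain ⟨C, hC⟩ := mem_domain_iff.1 h
  refine mem_domain_iff.2 ⟨C, fun t => ?_⟩
  rw [(S.completelyPositive t).map_star, ← star_sub, norm_star]
  exact hC t

theorem one_mem_domain : (1 : H →L[ℂ] H) ∈ S.generator.domain := ⟨0, hasDeriv_one⟩

/-- The quadratic form `u ↦ ⟪u, (T_t(A* A) - T_t(A)* T_t(A)) u⟫` is of order `t`. -/
def BoundedDefect (S : QuantumMarkovSemigroup H) (A : H →L[ℂ] H) : Prop :=
  ∃ C : ℝ, ∀ (t : ℝ≥0) (u : H), (tensorForm (opForm (S.map t)) (defect (S.map t) A u)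
    (defect (S.map t) A u)).re ≤ C * t * ‖u‖ ^ 2

theorem norm_mul_sub_le {A B : H →L[ℂ] H} (hA : A ∈ S.generator.domain)
    (hB : B ∈ S.generator.domain) :
    ∃ C : ℝ, ∀ t : ℝ≥0, ‖S.map t A * S.map t B - A * B‖ ≤ C * t := by
  obtain ⟨CA, hA⟩ := mem_domain_iff.1 hA
  obtain ⟨CB, hB⟩ := mem_domain_iff.1 hB
  refine ⟨‖A‖ * CB + CA * ‖B‖, fun t => ?_⟩
  have e : S.map t A * S.map t B - A * B =
      S.map t A * (S.map t B - B) + (S.map t A - A) * B := by noncomm_ring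
  rw [e]
  calc _ ≤ ‖S.map t A * (S.map t B - B)‖ + ‖(S.map t A - A) * B‖ := norm_add_le _ _
    _ ≤ ‖S.map t A‖ * ‖S.map t B - B‖ + ‖S.map t A - A‖ * ‖B‖ :=
      add_le_add (norm_mul_le _ _) (norm_mul_le _ _)
    _ ≤ ‖A‖ * (CB * t) + CA * t * ‖B‖ := by
      gcongr
      · exact S.norm_map_le t A
      · exact hB t
      · exact hA t
    _ = _ := by ring

theorem boundedDefect_iff {A : H →L[ℂ] H} (hA : A ∈ S.generator.domain) :
    S.BoundedDefect A ↔ star A * A ∈ S.generator.domain := by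
  obtain ⟨C1, h1⟩ := norm_mul_sub_le (star_mem_domain hA) hA
  constructor
  · rintro ⟨C, hC⟩
    have hC' : ∀ (t : ℝ≥0) (u : H), (tensorForm (opForm (S.map t)) (defect (S.map t) A u)
        (defect (S.map t) A u)).re ≤ |C| * t * ‖u‖ ^ 2 := fun t u =>
      (hC t u).trans (by gcongr; exact le_abs_self C)
    refine mem_domain_iff.2 ⟨|C| + C1, fun t => ?_⟩
    have hcp := S.completelyPositive t
    have h2 : ‖S.map t (star A * A) - star (S.map t A) * S.map t A‖ ≤ |C| * t := by
      refine norm_le_of_form_le (by positivity) (fun u => ?_) (fun u => ?_)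
      · rw [← hcp.form_defect (S.map_one t)]
        exact hcp.tensorForm_nonneg _
      · rw [← hcp.form_defect (S.map_one t)]
        exact hC' t u
    have h3 := h1 t
    rw [hcp.map_star] at h3
    calc _ = ‖(S.map t (star A * A) - star (S.map t A) * S.map t A) +
        (star (S.map t A) * S.map t A - star A * A)‖ := by congr 1; abel
      _ ≤ _ := norm_add_le _ _
      _ ≤ |C| * t + C1 * t := add_le_add h2 h3
      _ = _ := by ring
  · intro h
    obtain ⟨C, hC⟩ := mem_domain_iff.1 h
    refine ⟨C + C1, fun t u => ?_⟩
    have hcp := S.completelyPositive t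
    rw [hcp.form_defect (S.map_one t)]
    have h3 := h1 t
    rw [hcp.map_star] at h3
    have h2 : ‖S.map t (star A * A) - star (S.map t A) * S.map t A‖ ≤ (C + C1) * t := by
      calc _ = ‖(S.map t (star A * A) - star A * A) -
          (star (S.map t A) * S.map t A - star A * A)‖ := by congr 1; abel
        _ ≤ _ := norm_sub_le _ _
        _ ≤ C * t + C1 * t := add_le_add (hC t) h3
        _ = _ := by ring
    refine (Complex.re_le_norm _).trans ((norm_inner_le_norm _ _).trans ?_)
    calc _ ≤ ‖u‖ * (‖S.map t (star A * A) - star (S.map t A) * S.map t A‖ * ‖u‖) := by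
          gcongr; exact ContinuousLinearMap.le_opNorm _ _
      _ ≤ ‖u‖ * (((C + C1) * t) * ‖u‖) := by gcongr
      _ = _ := by ring

theorem BoundedDefect.add {A B : H →L[ℂ] H} (hA : S.BoundedDefect A) (hB : S.BoundedDefect B) :
    S.BoundedDefect (A + B) := by
  obtain ⟨CA, hA⟩ := hA
  obtain ⟨CB, hB⟩ := hB
  refine ⟨2 * CA + 2 * CB, fun t u => ?_⟩
  rw [defect_add]
  refine (form_add_le _ (S.completelyPositive t).tensorForm_nonneg _ _).trans ?_
  linarith [hA t u, hB t u]

theorem BoundedDefect.mul {A B : H →L[ℂ] H} (hA : A ∈ S.generator.domain)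
    (hB : B ∈ S.generator.domain) (hAB : A * B ∈ S.generator.domain) (dA : S.BoundedDefect A)
    (dB : S.BoundedDefect B) : S.BoundedDefect (A * B) := by
  obtain ⟨CA, dA⟩ := dA
  obtain ⟨CB, dB⟩ := dB
  obtain ⟨C1, h1⟩ := norm_mul_sub_le hA hB
  obtain ⟨C2, h2⟩ := mem_domain_iff.1 hAB
  refine ⟨2 * (‖A‖ ^ 2 * CB) + 2 * (2 * (|CA| * ‖B‖ ^ 2) +
    2 * ((C1 + C2) * (2 * ‖A‖ * ‖B‖))), fun t u => ?_⟩
  have hcp := S.completelyPositive t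
  set Φ := S.map t with hΦ
  have e1 := hcp.lmul_le A (defect Φ B u)
  have e2 := dB t u
  have e3 : (tensorForm (opForm Φ) (defect Φ A (Φ B u)) (defect Φ A (Φ B u))).re ≤
      |CA| * t * (‖B‖ ^ 2 * ‖u‖ ^ 2) := by
    refine (dA t (Φ B u)).trans ?_
    have : ‖Φ B u‖ ≤ ‖B‖ * ‖u‖ := (ContinuousLinearMap.le_opNorm _ _).trans (by
      gcongr; exact S.norm_map_le t B)
    rw [← mul_pow]
    gcongr
    exact le_abs_self _
  set Z := Φ A * Φ B - Φ (A * B) with hZ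
  have hZ1 : ‖Z‖ ≤ (C1 + C2) * t := by
    calc _ = ‖(Φ A * Φ B - A * B) - (Φ (A * B) - A * B)‖ := by congr 1; rw [hZ]; abel
      _ ≤ _ := norm_sub_le _ _
      _ ≤ C1 * t + C2 * t := add_le_add (h1 t) (h2 t)
      _ = _ := by ring
  have hZ2 : ‖Z‖ ≤ 2 * ‖A‖ * ‖B‖ := by
    have a1 : ‖Φ A * Φ B‖ ≤ ‖A‖ * ‖B‖ := (norm_mul_le _ _).trans (by
      gcongr <;> exact S.norm_map_le t _)
    have a2 : ‖Φ (A * B)‖ ≤ ‖A‖ * ‖B‖ := (S.norm_map_le t _).trans (norm_mul_le _ _)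
    calc _ ≤ _ := norm_sub_le _ _
      _ ≤ _ := by linarith
  have e4 : (tensorForm (opForm Φ) (1 ⊗ₜ (Z u)) (1 ⊗ₜ (Z u))).re ≤
      ((C1 + C2) * t * (2 * ‖A‖ * ‖B‖)) * ‖u‖ ^ 2 := by
    rw [form_one (S.map_one t), Complex.ofReal_re]
    have a1 : ‖Z u‖ ≤ ‖Z‖ * ‖u‖ := ContinuousLinearMap.le_opNorm _ _
    calc ‖Z u‖ ^ 2 ≤ (‖Z‖ * ‖u‖) ^ 2 := by gcongr
      _ = (‖Z‖ * ‖Z‖) * ‖u‖ ^ 2 := by ring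
      _ ≤ _ := by gcongr; exact (norm_nonneg _).trans hZ1
  rw [defect_mul]
  have f1 := form_add_le _ hcp.tensorForm_nonneg (lmul A (defect Φ B u))
    (defect Φ A (Φ B u) + 1 ⊗ₜ (Z u))
  have f2 := form_add_le _ hcp.tensorForm_nonneg (defect Φ A (Φ B u)) (1 ⊗ₜ (Z u))
  have e5 : ‖A‖ ^ 2 * (tensorForm (opForm Φ) (defect Φ B u) (defect Φ B u)).re ≤
      ‖A‖ ^ 2 * (CB * t * ‖u‖ ^ 2) := by gcongr
  refine f1.trans ?_
  linarith

/-- If `A`, `B`, `A* A` and `B* B` lie in the domain, so does `A* B` (by polarization). -/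
theorem star_mul_mem_domain {A B : H →L[ℂ] H} (hA : A ∈ S.generator.domain)
    (hB : B ∈ S.generator.domain) (dA : S.BoundedDefect A) (dB : S.BoundedDefect B) :
    star A * B ∈ S.generator.domain := by
  have key : ∀ c : ℂ, c * conj c = 1 →
      conj c • (star B * A) + c • (star A * B) ∈ S.generator.domain := by
    intro c hc
    have hcB : c • B ∈ S.generator.domain := S.generator.domain.smul_mem c hB
    have hBB := (boundedDefect_iff hB).1 dB
    have e : star (c • B) * (c • B) = star B * B := by
      rw [star_smul, smul_mul_smul_comm, mul_comm, Complex.star_def, hc, one_smul]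
    have dcB : S.BoundedDefect (c • B) := (boundedDefect_iff hcB).2 (by rwa [e])
    have h := (boundedDefect_iff (S.generator.domain.add_mem hA hcB)).1 (dA.add dcB)
    have h2 := S.generator.domain.sub_mem (S.generator.domain.sub_mem h
      ((boundedDefect_iff hA).1 dA)) hBB
    convert h2 using 1
    rw [star_add, add_mul, mul_add, mul_add, e, star_smul, smul_mul_assoc, mul_smul_comm,
      Complex.star_def]
    abel
  have h1 := key 1 (by simp)
  have h2 := key Complex.I (by simp)
  have h3 := S.generator.domain.smul_mem (-Complex.I) h2
  have h4 := S.generator.domain.smul_mem (2⁻¹ : ℂ) (S.generator.domain.add_mem h1 h3)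
  convert h4 using 1
  simp only [smul_add, smul_smul, Complex.conj_I, one_smul]
  match_scalars <;> (ring_nf; simp; try norm_num)

variable (S)

/-- The domain algebra of the generator: the largest `*`-subalgebra of `B(H)` contained in `D(L)`.
It consists of all `A ∈ D(L)` with `A* A ∈ D(L)` and `A A* ∈ D(L)`. -/
def domainAlgebra : StarSubalgebra ℂ (H →L[ℂ] H) where
  carrier := {A | A ∈ S.generator.domain ∧ star A * A ∈ S.generator.domain ∧
    A * star A ∈ S.generator.domain}
  star_mem' := by
    rintro A ⟨h, h1, h2⟩
    exact ⟨star_mem_domain h, by rwa [star_star], by rwa [star_star]⟩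
  add_mem' := by
    rintro A B ⟨hA, hA1, hA2⟩ ⟨hB, hB1, hB2⟩
    have hAB := S.generator.domain.add_mem hA hB
    have d1 := ((boundedDefect_iff hA).2 hA1).add ((boundedDefect_iff hB).2 hB1)
    have d2 := ((boundedDefect_iff (star_mem_domain hA)).2 (by rwa [star_star])).add
      ((boundedDefect_iff (star_mem_domain hB)).2 (by rwa [star_star]))
    rw [← star_add] at d2
    have h2 := (boundedDefect_iff (star_mem_domain hAB)).1 d2
    rw [star_star] at h2
    exact ⟨hAB, (boundedDefect_iff hAB).1 d1, h2⟩
  mul_mem' := by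
    rintro A B ⟨hA, hA1, hA2⟩ ⟨hB, hB1, hB2⟩
    have dA := (boundedDefect_iff hA).2 hA1
    have dB := (boundedDefect_iff hB).2 hB1
    have dA' := (boundedDefect_iff (star_mem_domain hA)).2 (by rwa [star_star])
    have dB' := (boundedDefect_iff (star_mem_domain hB)).2 (by rwa [star_star])
    have hAB : A * B ∈ S.generator.domain := by
      have h := star_mul_mem_domain (star_mem_domain hA) hB dA' dB
      rwa [star_star] at h
    have hAB' := star_mem_domain hAB
    have d1 := dA.mul hA hB hAB dB
    rw [star_mul] at hAB'
    have d2 := dB'.mul (star_mem_domain hB) (star_mem_domain hA) hAB' dA'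
    have h2 := (boundedDefect_iff hAB').1 d2
    rw [← star_mul, star_star] at h2
    exact ⟨hAB, (boundedDefect_iff hAB).1 d1, h2⟩
  algebraMap_mem' := by
    intro c
    have h : ∀ d : ℂ, algebraMap ℂ (H →L[ℂ] H) d ∈ S.generator.domain := fun d => by
      rw [Algebra.algebraMap_eq_smul_one]
      exact S.generator.domain.smul_mem d one_mem_domain
    refine ⟨h c, ?_, ?_⟩ <;>
    · rw [← algebraMap_star_comm, ← map_mul]
      exact h _

theorem mem_domainAlgebra {A : H →L[ℂ] H} : A ∈ S.domainAlgebra ↔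
    A ∈ S.generator.domain ∧ star A * A ∈ S.generator.domain ∧
      A * star A ∈ S.generator.domain := Iff.rfl

theorem domainAlgebra_isGreatest :
    IsGreatest {B : StarSubalgebra ℂ (H →L[ℂ] H) | ∀ A ∈ B, A ∈ S.generator.domain}
      S.domainAlgebra :=
  ⟨fun _ hA => hA.1, fun _ hB _ hA =>
    ⟨hB _ hA, hB _ (mul_mem (star_mem hA) hA), hB _ (mul_mem hA (star_mem hA))⟩⟩

end QuantumMarkovSemigroup

end DomainAlgebra

/-! ### The dilation of a completely positive map into sesquilinear forms -/

section Dilation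

variable {H : Type*} [NormedAddCommGroup H] [InnerProductSpace ℂ H] [CompleteSpace H]

/-- Sesquilinear forms on `U × U`, conjugate linear in the first variable. -/
abbrev SesqForm (U : Submodule ℂ H) : Type _ := U →ₗ⋆[ℂ] U →ₗ[ℂ] ℂ

/-- `φ` is `U`-completely positive: `∑ φ(A_ij)(u_i, u_j) ≥ 0` for every positive matrix
`(A_ij)` with entries in `𝒜` and all `u_1, …, u_k` in `U`. -/
def IsUCompletelyPositive {𝒜 : StarSubalgebra ℂ (H →L[ℂ] H)} {U : Submodule ℂ H}
    (φ : 𝒜 →ₗ[ℂ] SesqForm U) : Prop :=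
  ∀ (k : ℕ) (A : Matrix (Fin k) (Fin k) 𝒜),
    IsPositiveMatrix (A.map fun a => (a : H →L[ℂ] H)) →
      ∀ u : Fin k → U, 0 ≤ ∑ i, ∑ j, φ (A i j) (u i) (u j)

variable {𝒜 : StarSubalgebra ℂ (H →L[ℂ] H)} {U : Submodule ℂ H} {φ : 𝒜 →ₗ[ℂ] SesqForm U}

theorem IsUCompletelyPositive.tensorForm_nonneg (hφ : IsUCompletelyPositive φ) (x : 𝒜 ⊗[ℂ] U) :
    0 ≤ tensorForm φ x x :=
  QMS.tensorForm_nonneg φ (fun n A u =>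
    hφ n (Matrix.of fun i j => star (A i) * A j)
      (isPositiveMatrix_gram fun i => (A i : H →L[ℂ] H)) u) x

/-- The algebraic tensor product `𝒜 ⊗ U`, regarded as a space with the semi-inner product
`(A ⊗ u, B ⊗ v) = φ(A* B)(u, v)`. -/
def PreDilation (_hφ : IsUCompletelyPositive φ) : Type _ := 𝒜 ⊗[ℂ] U

variable (hφ : IsUCompletelyPositive φ)

noncomputable instance : AddCommGroup (PreDilation hφ) :=
  inferInstanceAs (AddCommGroup (𝒜 ⊗[ℂ] U))

noncomputable instance : Module ℂ (PreDilation hφ) := inferInstanceAs (Module ℂ (𝒜 ⊗[ℂ] U))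

/-- The identity map from `𝒜 ⊗ U` to the semi-inner product space. -/
noncomputable def toPreDilation : 𝒜 ⊗[ℂ] U ≃ₗ[ℂ] PreDilation hφ := LinearEquiv.refl ℂ (𝒜 ⊗[ℂ] U)

/-- The semi-inner product `(A ⊗ u, B ⊗ v) = φ(A* B)(u, v)`. -/
noncomputable abbrev preDilationCore : PreInnerProductSpace.Core ℂ (PreDilation hφ) where
  inner x y := tensorForm φ ((toPreDilation hφ).symm x) ((toPreDilation hφ).symm y)
  conj_inner_symm x y := conj_symm_of_nonneg _ hφ.tensorForm_nonneg _ _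
  re_inner_nonneg x := (Complex.nonneg_iff.1 (hφ.tensorForm_nonneg _)).1
  add_left x y z := by simp
  smul_left x y r := by simp

noncomputable instance : SeminormedAddCommGroup (PreDilation hφ) :=
  InnerProductSpace.Core.toSeminormedAddCommGroup (c := preDilationCore hφ)

noncomputable instance : InnerProductSpace ℂ (PreDilation hφ) :=
  InnerProductSpace.ofCore (preDilationCore hφ)

theorem preDilation_inner (A B : 𝒜) (u v : U) :
    ⟪toPreDilation hφ (A ⊗ₜ u), toPreDilation hφ (B ⊗ₜ v)⟫_ℂ = φ (star A * B) u v :=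
  tensorForm_tmul φ A B u v

/-- The dilation space `𝒦`: the completion of `(𝒜 ⊗ U) / N`, where `N` is the subspace of null
vectors of the semi-inner product. -/
abbrev DilationSpace : Type _ := UniformSpace.Completion (SeparationQuotient (PreDilation hφ))

/-- The dilation map `V : U → 𝒦`, `V u = 1 ⊗ u + N`. -/
noncomputable def dilationMap : U →ₗ[ℂ] DilationSpace hφ :=
  (UniformSpace.Completion.toComplₗᵢ (𝕜 := ℂ)
      (E := SeparationQuotient (PreDilation hφ))).toLinearMap ∘ₗ
    (SeparationQuotient.mkCLM ℂ (PreDilation hφ)).toLinearMap ∘ₗ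
      (toPreDilation hφ).toLinearMap ∘ₗ TensorProduct.mk ℂ 𝒜 U 1

theorem dilationMap_apply (u : U) : dilationMap hφ u =
    ((SeparationQuotient.mk (toPreDilation hφ (1 ⊗ₜ u)) :
      SeparationQuotient (PreDilation hφ)) : DilationSpace hφ) := rfl

end Dilation

/-! ### The subspace `U` and the operator `G` -/

section Operators

variable {H : Type*} [NormedAddCommGroup H] [InnerProductSpace ℂ H] [CompleteSpace H]

/-- The rank one operator `|x⟩⟨y| : v ↦ ⟪y, v⟫ x`. -/
noncomputable def ketBra (x y : H) : H →L[ℂ] H := InnerProductSpace.rankOne ℂ x y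

theorem ketBra_apply (x y v : H) : ketBra x y v = ⟪y, v⟫_ℂ • x := rfl

/-- `h` is an associate vector of the positive finite rank operator `T`: for some spectral
decomposition `T = ∑ t'_s |k'_s⟩⟨k'_s|` with `k'_1, …, k'_m` orthonormal, `m ≥ 1` and `t'_s > 0`,
`h = ∑ ‖k_s‖⁻² k_s` where `k_s = √t k'_s` and `t = ∑ t'_s`. -/
def IsAssociateVector (T : H →L[ℂ] H) (h : H) : Prop :=
  ∃ (m : ℕ) (k' : Fin m → H) (t' : Fin m → ℝ), 0 < m ∧ Orthonormal ℂ k' ∧ (∀ s, 0 < t' s) ∧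
    T = ∑ s, (t' s : ℂ) • ketBra (k' s) (k' s) ∧
    ∃ k : Fin m → H, (∀ s, k s = ((√(∑ r, t' r) : ℝ) : ℂ) • k' s) ∧
      h = ∑ s, ((‖k s‖ ^ 2 : ℝ) : ℂ)⁻¹ • k s

namespace QuantumMarkovSemigroup

variable (S : QuantumMarkovSemigroup H)

/-- The subspace `{x | |x⟩⟨e| ∈ 𝒜}`, where `𝒜` is the domain algebra. -/
def ketSpace (e : H) : Submodule ℂ H where
  carrier := {x | ketBra x e ∈ S.domainAlgebra}
  add_mem' {x y} hx hy := by
    have : ketBra (x + y) e = ketBra x e + ketBra y e := by ext; simp [ketBra_apply]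
    rw [Set.mem_ofPred_eq, this]
    exact add_mem hx hy
  zero_mem' := by
    have : ketBra (0 : H) e = 0 := by ext; simp [ketBra_apply]
    rw [Set.mem_ofPred_eq, this]
    exact zero_mem _
  smul_mem' c x hx := by
    have : ketBra (c • x) e = c • ketBra x e := by ext; simp [ketBra_apply, smul_comm c]
    rw [Set.mem_ofPred_eq, this]
    exact SMulMemClass.smul_mem c hx

variable {S}

theorem domainAlgebra_le {A : H →L[ℂ] H} (hA : A ∈ S.domainAlgebra) : A ∈ S.generator.domain :=
  hA.1

/-- The domain algebra leaves `{x | |x⟩⟨e| ∈ 𝒜}` invariant. -/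
theorem apply_mem_ketSpace {e v : H} {A : H →L[ℂ] H} (hA : A ∈ S.domainAlgebra)
    (hv : v ∈ S.ketSpace e) : A v ∈ S.ketSpace e := by
  have : ketBra (A v) e = A * ketBra v e := by ext; simp [ketBra_apply]
  change ketBra (A v) e ∈ S.domainAlgebra
  rw [this]
  exact mul_mem hA hv

variable (S)

/-- `|x⟩⟨e|` as an element of the domain of the generator, for `x` with `|x⟩⟨e| ∈ 𝒜`. -/
noncomputable def ketDomain (e : H) (x : S.ketSpace e) : S.generator.domain :=
  ⟨ketBra (x : H) e, domainAlgebra_le x.2⟩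

/-- The operator `G x = L(|x⟩⟨Th|) h - ½ ⟪h, L(T) h⟫ x` on `U = {x | |x⟩⟨Th| ∈ 𝒜}`. -/
noncomputable def G (T : S.generator.domain) (h : H) :
    S.ketSpace ((T : H →L[ℂ] H) h) →ₗ[ℂ] H where
  toFun x := S.generator (S.ketDomain _ x) h - ((1 / 2 : ℂ) * ⟪h, S.generator T h⟫_ℂ) • (x : H)
  map_add' x y := by
    have : S.ketDomain _ (x + y) = S.ketDomain _ x + S.ketDomain _ y := by
      ext; simp [ketDomain, ketBra_apply]
    rw [this, LinearPMap.map_add, add_apply, Submodule.coe_add, smul_add]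
    abel
  map_smul' c x := by
    have : S.ketDomain _ (c • x) = c • S.ketDomain _ x := by
      ext; simp [ketDomain, ketBra_apply, smul_comm c]
    rw [this, LinearPMap.map_smul, smul_apply, Submodule.coe_smul, RingHom.id_apply, smul_sub,
      smul_comm c]

/-- `⟪u, L(A) v⟫ = φ(A)(u, v) + ⟪u, G A v⟫ + ⟪G A* u, v⟫` for all `A ∈ 𝒜` and `u, v ∈ U`. -/
def GeneratorForm (T : S.generator.domain) (h : H)
    (φ : S.domainAlgebra →ₗ[ℂ] SesqForm (S.ketSpace ((T : H →L[ℂ] H) h))) : Prop :=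
  ∀ (A : S.domainAlgebra) (u v : S.ketSpace ((T : H →L[ℂ] H) h)),
    ⟪(u : H), S.generator ⟨A, domainAlgebra_le A.2⟩ (v : H)⟫_ℂ =
      φ A u v
      + ⟪(u : H), S.G T h ⟨(A : H →L[ℂ] H) v, apply_mem_ketSpace A.2 v.2⟩⟫_ℂ
      + ⟪S.G T h ⟨(star (A : H →L[ℂ] H)) u, apply_mem_ketSpace (star_mem A.2) u.2⟩, (v : H)⟫_ℂ

end QuantumMarkovSemigroup

end Operators

end QMS

/-! ### Norm estimates for `G` and for the dilation map `V` -/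

namespace QMS

/-! Boundedness of `G` is the triangle inequality: `G` is the map `x ↦ L(|x⟩⟨Th|)h`, bounded by
assumption, minus a fixed scalar multiple of the inclusion of `U` in the Hilbert space. This gives
the explicit constant `D = C + ‖½⟪h, L(T)h⟫‖` (`norm_G_le`).

For `V`, everything is decided at the unit of the algebra. On the one hand `‖Vu‖² = φ(1)(u, u)`,
because `V u` is the class of `1 ⊗ u` and `1* 1 = 1` (`norm_dilationMap_sq`). On the other hand the
semigroup is unital, so `L(1) = 0` (`generator_one`), and the assumed decomposition of `L` at `A =
1` reads `0 = φ(1)(u, v) + ⟪u, Gv⟫ + ⟪Gu, v⟫` (`GeneratorForm.apply_one`). Hence `‖Vu‖² = -2 Re⟪u,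
Gu⟫`, which Cauchy–Schwarz bounds by `2‖u‖‖Gu‖ ≤ 2D‖u‖²`.

So a bound on `G` passes to `V` with constant `√(2D)`. That constant depends only on `C`, `T`, `h`
and the semigroup, and is the same for every admissible `φ`. Complete positivity enters the second
part through the construction of the dilation space: it makes the form on `𝒜 ⊗ U` a semi-inner
product. -/

theorem QuantumMarkovSemigroup.norm_G_le {H : Type*} [NormedAddCommGroup H]
    [InnerProductSpace ℂ H] [CompleteSpace H] (S : QuantumMarkovSemigroup H)
    (T : S.generator.domain) (h : H) {C : ℝ}
    (hC : ∀ x : S.ketSpace ((T : H →L[ℂ] H) h), ‖S.generator (S.ketDomain _ x) h‖ ≤ C * ‖x‖)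
    (x : S.ketSpace ((T : H →L[ℂ] H) h)) :
    ‖S.G T h x‖ ≤ (C + ‖(1 / 2 : ℂ) * ⟪h, S.generator T h⟫_ℂ‖) * ‖x‖ := by
  rw [add_mul]
  -- `G x` is by definition a difference. The hypothesis handles its first term, and what is left is
  -- the norm of a scalar multiple of `x`.
  refine (norm_sub_le _ _).trans (add_le_add (hC x) ?_)
  rw [norm_smul, Submodule.coe_norm]

/-- Since `T_t(1) = 1`, all difference quotients at the unit vanish. The value of the generator is
only known as some chosen sigma-weak limit, so uniqueness of such limits identifies it with `0`.
This is what removes the left side of the generator form at `A = 1`. -/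
theorem QuantumMarkovSemigroup.generator_one {H : Type*} [NormedAddCommGroup H]
    [InnerProductSpace ℂ H] (S : QuantumMarkovSemigroup H)
    (h : (1 : H →L[ℂ] H) ∈ S.generator.domain) : S.generator ⟨1, h⟩ = 0 :=
  (S.generator_hasDeriv ⟨1, h⟩).unique hasDeriv_one

/-- Neither passing to the quotient by null vectors nor completing changes norms, so the norm of `V
u` is the seminorm of `1 ⊗ u`, whose square is given by the form at `1* 1 = 1`. The identity is
stated in `ℂ`, where `φ` takes its values; in particular it shows that `φ(1)(u, u)` is real and
nonnegative. -/
theorem norm_dilationMap_sq {H : Type*} [NormedAddCommGroup H] [InnerProductSpace ℂ H]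
    [CompleteSpace H] {𝒜 : StarSubalgebra ℂ (H →L[ℂ] H)} {U : Submodule ℂ H}
    {φ : 𝒜 →ₗ[ℂ] SesqForm U} (hφ : IsUCompletelyPositive φ) (u : U) :
    ((‖dilationMap hφ u‖ ^ 2 : ℝ) : ℂ) = φ 1 u u := by
  -- Descend from the completion to the quotient, then to the semi-inner product space itself.
  rw [dilationMap_apply, UniformSpace.Completion.norm_coe, SeparationQuotient.norm_mk]
  have := preDilation_inner hφ 1 1 u u
  rw [star_one, one_mul, inner_self_eq_norm_sq_to_K] at this
  rw [← this]
  simp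

/-- The generator form at `A = 1` expresses `φ(1)` through `G`, because `L(1) = 0`. -/
theorem QuantumMarkovSemigroup.GeneratorForm.apply_one {H : Type*} [NormedAddCommGroup H]
    [InnerProductSpace ℂ H] [CompleteSpace H] {S : QuantumMarkovSemigroup H}
    {T : S.generator.domain} {h : H}
    {φ : S.domainAlgebra →ₗ[ℂ] SesqForm (S.ketSpace ((T : H →L[ℂ] H) h))}
    (hG : S.GeneratorForm T h φ) (u v : S.ketSpace ((T : H →L[ℂ] H) h)) :
    φ 1 u v = -(⟪(u : H), S.G T h v⟫_ℂ + ⟪S.G T h u, (v : H)⟫_ℂ) := by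
  have key := hG 1 u v
  -- At the unit both `A v` and `A* u` collapse to the original vectors; `Subtype.coe_eta` then
  -- identifies the elements of `U` rebuilt from the invariance of `U` with `v` and `u` themselves.
  simp only [OneMemClass.coe_one, generator_one, star_one, one_apply_eq_self, zero_apply,
    inner_zero_right, Subtype.coe_eta] at key
  linear_combination -key

end QMS

theorem proposition5p1 {H : Type*} [NormedAddCommGroup H] [InnerProductSpace ℂ H] [CompleteSpace H]
    (S : QMS.QuantumMarkovSemigroup H)
    (T : S.generator.domain)
    (hTpos : (T : H →L[ℂ] H).IsPositive)
    (hTfin : FiniteDimensional ℂ (LinearMap.range (T : H →L[ℂ] H).toLinearMap))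
    (h : H) (hh : QMS.IsAssociateVector (T : H →L[ℂ] H) h)
    (hTh : QMS.ketBra ((T : H →L[ℂ] H) h) ((T : H →L[ℂ] H) h) ∈ S.generator.domain)
    (hL : ∃ C : ℝ, 0 < C ∧ ∀ x : S.ketSpace ((T : H →L[ℂ] H) h),
      ‖S.generator (S.ketDomain _ x) h‖ ≤ C * ‖x‖) :
    (∃ C : ℝ, ∀ x : S.ketSpace ((T : H →L[ℂ] H) h), ‖S.G T h x‖ ≤ C * ‖x‖) ∧
    ∀ (φ : S.domainAlgebra →ₗ[ℂ] QMS.SesqForm (S.ketSpace ((T : H →L[ℂ] H) h)))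
      (hφ : QMS.IsUCompletelyPositive φ), S.GeneratorForm T h φ →
      ∃ C : ℝ, ∀ x : S.ketSpace ((T : H →L[ℂ] H) h), ‖QMS.dilationMap hφ x‖ ≤ C * ‖x‖ := by
  obtain ⟨C, hC0, hC⟩ := hL
  have hG := S.norm_G_le T h hC
  refine ⟨⟨_, hG⟩, fun φ hφ hform => ?_⟩
  set D := C + ‖(1 / 2 : ℂ) * ⟪h, S.generator T h⟫_ℂ‖
  -- Positivity of `C` enters here; it makes `√(2 * D)` square back to `2 * D` below.
  have hD : 0 ≤ D := by positivity
  -- The factor `2` counts the two terms `⟪x, Gx⟫` and `⟪Gx, x⟫`, each at most `D‖x‖²` in modulus.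
  -- The estimate is quadratic in `V`, hence the square root and the comparison of squares.
  refine ⟨√(2 * D), fun x => ?_⟩
  refine (sq_le_sq₀ (norm_nonneg _) (by positivity)).1 ?_
  rw [mul_pow, Real.sq_sqrt (by positivity)]
  -- The two expressions for `φ(1)(x, x)` agree as complex numbers. Taking absolute values returns
  -- `‖Vx‖²` as a real number and discards the minus sign, so real parts need not be discussed.
  have e := congrArg norm ((QMS.norm_dilationMap_sq hφ x).trans (hform.apply_one x x))
  rw [Complex.norm_real, Real.norm_of_nonneg (sq_nonneg _), norm_neg] at e
  calc _ = _ := e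
    _ ≤ ‖(x : H)‖ * ‖S.G T h x‖ + ‖S.G T h x‖ * ‖(x : H)‖ :=
      (norm_add_le _ _).trans (add_le_add (norm_inner_le_norm _ _) (norm_inner_le_norm _ _))
    -- The norm of `x` in `U` is its norm in the ambient space; after that identification the bound
    -- on `G` is applied once in each term.
    _ ≤ ‖x‖ * (D * ‖x‖) + D * ‖x‖ * ‖x‖ := by
      rw [← Submodule.coe_norm]
      gcongr <;> exact hG x
    _ = 2 * D * ‖x‖ ^ 2 := by ring
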